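/- Let $a:[1,\infty)\to[0,\infty)$ be a monotonically increasing (i.e. non-decreasing) function whose values $a(n)$ at the positive integers are not all zero, and suppose that the Dirichlet series $L(s)=\sum_{n\ge 1}a(n)n^{-s}$ converges and is analytic for $\Re(s)>1$. Let $N\ge 1$ be an integer and let $$P_N(x)=\sum_{n=1}^{\infty}\frac{a(n)}{n}\left(\{nx\}^{N}+N!\sum_{k=0}^{N-1}\frac{(-1)^k\zeta(-k)}{(N-k)!\,k!}\right),$$ a function defined at those real $x$ for which the series converges, where $\{y\}=y-\lfloor y\rfloor$ and $\zeta$ is the Riemann zeta function. For a function $v$ on $(0,\infty)$ let $K^{v}$ be the class of real functions $f$, defined on a subset of $\mathbb{R}$, for which there are constants $C$ and $\delta>0$ such that $$|f(x+h)-f(x)|\le C\,|v(h)|$$ for all irrational $h\in(0,\delta)$ and all irrational $x$ such that $f$ is defined at $x$ and at $x+h$. Then $P_N\notin K^{v}$ for $v(h)=h^{-1}a(1/h)$. -/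

import Mathlib

open Filter Topology

noncomputable section

/-- `M`-th partial sum, at the point `x`, of
`∑_{n ≥ 1} (a(n)/n) ({nx}^N + N! ∑_{k=0}^{N-1} (-1)^k ζ(-k) / ((N-k)! k!))`.
The values `ζ(-k)` are real, so taking the real part loses nothing. -/
def davenportPartialSum (a : ℝ → ℝ) (N : ℕ) (x : ℝ) (M : ℕ) : ℝ :=
  ∑ n ∈ Finset.Icc 1 M, a (n : ℝ) / (n : ℝ) *
    (Int.fract ((n : ℝ) * x) ^ N +
      (N.factorial : ℝ) * ∑ k ∈ Finset.range N,
        (-1 : ℝ) ^ k * (riemannZeta (-(k : ℂ))).re /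
          (((N - k).factorial : ℝ) * (k.factorial : ℝ)))

/-- The function `P_N`, a partial function on `ℝ`: it is defined exactly at the points where the
series converges (in the order of summation `n = 1, 2, 3, …`), and its value is the sum. -/
def davenportP (a : ℝ → ℝ) (N : ℕ) : ℝ →. ℝ := fun x =>
  { Dom := ∃ l : ℝ, Tendsto (davenportPartialSum a N x) atTop (𝓝 l)
    get := fun h => Classical.choose h }

/-- `P_N(x)` is defined and equal to `y` iff the series at `x` converges to `y`. -/
theorem mem_davenportP_iff (a : ℝ → ℝ) (N : ℕ) (x y : ℝ) :
    y ∈ davenportP a N x ↔ Tendsto (davenportPartialSum a N x) atTop (𝓝 y) := by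
  constructor
  · rintro ⟨h, rfl⟩
    exact Classical.choose_spec h
  · intro h
    have hd : ∃ l : ℝ, Tendsto (davenportPartialSum a N x) atTop (𝓝 l) := ⟨y, h⟩
    exact ⟨hd, tendsto_nhds_unique (Classical.choose_spec hd) h⟩

/-- The class `K^v`: `sup_x |f(x+h) - f(x)| = O(v(h))` as `h → 0+`, where `h` runs through the
irrational numbers and `x` through the irrational numbers such that `f` is defined at `x` and
at `x + h`. For an everywhere defined `f` there is no condition of the last kind. -/
def classK (v : ℝ → ℝ) : Set (ℝ →. ℝ) :=
  {f | ∃ C : ℝ, ∀ᶠ h in 𝓝[>] (0 : ℝ), Irrational h →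
    ∀ x : ℝ, Irrational x → ∀ y ∈ f x, ∀ z ∈ f (x + h), |z - y| ≤ C * |v h|}

/-- The Dirichlet series `L(s) = ∑_{n ≥ 1} a(n) n^{-s}` converges for `Re s > 1` and its sum is
analytic there. For `a ≥ 0` convergence in this half-plane is absolute convergence. -/
def DirichletSeriesAnalytic (a : ℝ → ℝ) : Prop :=
  (∀ s : ℂ, 1 < s.re → LSeriesSummable (fun n : ℕ => ((a (n : ℝ) : ℝ) : ℂ)) s) ∧
    AnalyticOnNhd ℂ (LSeries (fun n : ℕ => ((a (n : ℝ) : ℝ) : ℂ))) {s : ℂ | 1 < s.re}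

end

/-!
Write `f(x) = {x}^N - 1/(N+1)`. By the recurrence for the Bernoulli numbers the constant in the
definition of `P_N` is `-1/(N+1)`, so that `P_N(x) = ∑ a(n)/n f(nx)` with `f` of mean zero.
The proof shows that `P_N` is defined almost everywhere and that it is not essentially bounded
below on any interval `(0, ε)`. This excludes every modulus of continuity `v` that is bounded on
compact subsets of `(0, ε)`: if `z > 0` is small and `P_N(z)` is defined, then for `x ∈ (0, z/2]` the increment
`h = z - x` lies in `[z/2, z)`, where `v(h)` is bounded, so an estimate
`|P_N(x + h) - P_N(x)| ≤ C |v(h)|` bounds `P_N` from below almost everywhere on `(0, z/2]`.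

Convergence almost everywhere (`ae_summable_davenportBlock`, `tendsto_davenportPartialSum`).
Summability of the Dirichlet series at `9/8` and monotonicity give `a(n) = O(n^{1/8})`. The
correlation of `f(mx)` and `f(nx)` over a period is at most `gcd(m, n)/n`
(`abs_integral_centeredFractPow_mul_le`). Within a block `k² < n ≤ (k+1)²` distinct indices
have greatest common divisor at most `2k`, so the mean square of the block is `O(k^{-5/2})`
and its `L¹` norm is `O(k^{-5/4})`, which is summable. The total mass of a block tends to zero,
so the partial sums inside a block do no harm.

Unboundedness (`not_ae_le_tsum_davenportBlock`). Summability of the `L¹` norms also allows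
integration over `(0, T)` term by term. The primitive of `f` vanishing at `0` is never positive,
and it is at most `-u/(2(N+1))` for `0 ≤ u ≤ 1/2`. Hence the mean of `P_N` over `(0, T)` is at most
`-1/(2(N+1)) ∑_{n ≤ R²} a(n)/n` as soon as `R² T ≤ 1/2`, and this tends to `-∞` as `T → 0`
because a nonzero monotone `a` makes `∑ a(n)/n` diverge.
-/

open MeasureTheory

/-! ### The centered power of the fractional part -/

/-- The function `x ↦ {x}^N - 1/(N+1)`: the `N`-th power of the fractional part, minus its mean
over a period. -/
noncomputable def centeredFractPow (N : ℕ) (x : ℝ) : ℝ := Int.fract x ^ N - 1 / ((N : ℝ) + 1)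

theorem centeredFractPow_periodic (N : ℕ) : Function.Periodic (centeredFractPow N) 1 := by
  intro x
  simp [centeredFractPow]

theorem centeredFractPow_add_nat (N : ℕ) (x : ℝ) (j : ℕ) :
    centeredFractPow N (x + j) = centeredFractPow N x := by
  simp [centeredFractPow]

theorem measurable_centeredFractPow (N : ℕ) : Measurable (centeredFractPow N) :=
  (measurable_fract.pow_const N).sub_const _

theorem abs_centeredFractPow_le (N : ℕ) (x : ℝ) : |centeredFractPow N x| ≤ 1 := by
  have h0 : 0 ≤ Int.fract x ^ N := pow_nonneg (Int.fract_nonneg x) N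
  have h1 : Int.fract x ^ N ≤ 1 := pow_le_one₀ (Int.fract_nonneg x) (Int.fract_lt_one x).le
  have h2 : (0 : ℝ) ≤ 1 / ((N : ℝ) + 1) := by positivity
  have h3 : 1 / ((N : ℝ) + 1) ≤ 1 := by
    rw [div_le_one (by positivity)]
    linarith [Nat.cast_nonneg (α := ℝ) N]
  rw [centeredFractPow, abs_le]
  constructor <;> linarith

/-- The constant in `davenportPartialSum` is minus the mean of `{x}^N`: the values `ζ(-k)` are
Bernoulli numbers, and the sum is the recurrence `∑_{k ≤ N} (N+1 choose k) B_k = 0`. -/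
theorem zetaConstant_eq {N : ℕ} (hN : 1 ≤ N) :
    (N.factorial : ℝ) * ∑ k ∈ Finset.range N,
      (-1 : ℝ) ^ k * (riemannZeta (-(k : ℂ))).re / (((N - k).factorial : ℝ) * (k.factorial : ℝ))
      = -(1 / ((N : ℝ) + 1)) := by
  have hz : ∀ k : ℕ, (-1 : ℝ) ^ k * (riemannZeta (-(k : ℂ))).re
      = (bernoulli (k + 1) : ℝ) / ((k : ℝ) + 1) := by
    intro k
    have h1 : riemannZeta (-(k : ℂ))
        = (((-1 : ℝ) ^ k * (bernoulli (k + 1) : ℝ) / ((k : ℝ) + 1) : ℝ) : ℂ) := by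
      rw [riemannZeta_neg_nat_eq_bernoulli]
      push_cast
      rfl
    rw [h1, Complex.ofReal_re, mul_div_assoc, ← mul_assoc, ← mul_pow]
    norm_num
  have hB : ∑ k ∈ Finset.range N, ((N + 1).choose (k + 1) : ℝ) * (bernoulli (k + 1) : ℝ) = -1 := by
    have h := sum_bernoulli (N + 1)
    rw [Finset.sum_range_succ', if_neg (by omega)] at h
    have h' := congrArg (fun q : ℚ => (q : ℝ)) h
    simp only [Rat.cast_add, Rat.cast_sum, Rat.cast_mul, Rat.cast_natCast, bernoulli_zero,
      Nat.choose_zero_right, Nat.cast_one, Rat.cast_one, Rat.cast_zero, mul_one] at h'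
    linarith
  have hterm : ∀ k ∈ Finset.range N,
      (N.factorial : ℝ) * ((-1 : ℝ) ^ k * (riemannZeta (-(k : ℂ))).re /
        (((N - k).factorial : ℝ) * (k.factorial : ℝ)))
      = 1 / ((N : ℝ) + 1) * (((N + 1).choose (k + 1) : ℝ) * (bernoulli (k + 1) : ℝ)) := by
    intro k hk
    have hk' : k + 1 ≤ N + 1 := by have := Finset.mem_range.1 hk; omega
    rw [hz, Nat.cast_choose ℝ hk', Nat.add_sub_add_right, Nat.factorial_succ, Nat.factorial_succ]
    have h1 := Nat.factorial_ne_zero k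
    have h2 := Nat.factorial_ne_zero (N - k)
    push_cast
    field_simp
  rw [Finset.mul_sum, Finset.sum_congr rfl hterm, ← Finset.mul_sum, hB]
  ring

theorem davenportPartialSum_eq (a : ℝ → ℝ) {N : ℕ} (hN : 1 ≤ N) (x : ℝ) (M : ℕ) :
    davenportPartialSum a N x M
      = ∑ n ∈ Finset.Icc 1 M, a n / n * centeredFractPow N (n * x) := by
  simp only [davenportPartialSum, zetaConstant_eq hN, centeredFractPow, sub_eq_add_neg]

/-! ### Equidistributed sums and correlations of dilates -/

/-- Comparison of an equally spaced Riemann sum of `x ↦ x^N` on `[0, 1]` with the integral. -/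
theorem abs_sum_range_div_pow_sub_le (N : ℕ) {n : ℕ} (hn : 0 < n) {r : ℝ} (h0 : 0 ≤ r)
    (h1 : r < 1) :
    |∑ i ∈ Finset.range n, ((((i : ℝ) + r) / n) ^ N - 1 / ((N : ℝ) + 1))| ≤ 1 := by
  have hn' : (0 : ℝ) < n := by exact_mod_cast hn
  have hmono : MonotoneOn (fun t : ℝ => (t / n) ^ N) (Set.Icc (0 : ℝ) (0 + (n : ℕ))) := by
    intro s hs t _ hst
    have := hs.1
    dsimp only
    gcongr
  have hint : ∫ t in (0 : ℝ)..(0 + (n : ℕ)), (t / n) ^ N = n * (1 / ((N : ℝ) + 1)) := by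
    rw [intervalIntegral.integral_comp_div (fun t : ℝ => t ^ N) hn'.ne', integral_pow]
    simp [hn'.ne']
  have hlow := hmono.sum_le_integral
  have hupp := hmono.integral_le_sum
  rw [hint] at hlow hupp
  -- The upper and lower Riemann sums differ by the last value minus the first.
  have htel : ∑ i ∈ Finset.range n, (((0 : ℝ) + ((i + 1 : ℕ) : ℝ)) / n) ^ N
      ≤ ∑ i ∈ Finset.range n, (((0 : ℝ) + (i : ℝ)) / n) ^ N + 1 := by
    have h := Finset.sum_range_sub (fun i : ℕ => (((0 : ℝ) + (i : ℝ)) / n) ^ N) n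
    rw [Finset.sum_sub_distrib] at h
    have h2 : (((0 : ℝ) + (n : ℝ)) / n) ^ N = 1 := by rw [zero_add, div_self hn'.ne', one_pow]
    have h3 : (0 : ℝ) ≤ (((0 : ℝ) + ((0 : ℕ) : ℝ)) / n) ^ N := by positivity
    rw [h2] at h
    linarith
  have ha : ∑ i ∈ Finset.range n, (((0 : ℝ) + (i : ℝ)) / n) ^ N
      ≤ ∑ i ∈ Finset.range n, (((i : ℝ) + r) / n) ^ N := by
    refine Finset.sum_le_sum fun i _ => pow_le_pow_left₀ (by positivity) ?_ N
    exact div_le_div_of_nonneg_right (by linarith) hn'.le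
  have hb : ∑ i ∈ Finset.range n, (((i : ℝ) + r) / n) ^ N
      ≤ ∑ i ∈ Finset.range n, (((0 : ℝ) + ((i + 1 : ℕ) : ℝ)) / n) ^ N := by
    refine Finset.sum_le_sum fun i _ => pow_le_pow_left₀ (by positivity) ?_ N
    refine div_le_div_of_nonneg_right ?_ hn'.le
    push_cast
    linarith
  rw [Finset.sum_sub_distrib, Finset.sum_const, Finset.card_range, nsmul_eq_mul, abs_le]
  constructor <;> linarith

/-- If `m` is prime to `n`, then the points `y + m j / n` are, modulo one, the points
`(i + r) / n` with `r = {n y}`. -/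
theorem abs_sum_centeredFractPow_le_one (N : ℕ) {m n : ℕ} (hn : 0 < n) (hmn : m.Coprime n)
    (y : ℝ) :
    |∑ j ∈ Finset.range n, centeredFractPow N (y + m * j / n)| ≤ 1 := by
  have hn' : (0 : ℝ) < n := by exact_mod_cast hn
  have hnz : (0 : ℤ) < n := by exact_mod_cast hn
  set r := Int.fract ((n : ℝ) * y) with hr
  set q := ⌊(n : ℝ) * y⌋ with hq
  have hqr : (q : ℝ) + r = n * y := Int.floor_add_fract _
  let φ : ℕ → ℕ := fun j => ((q + m * j) % n).toNat
  have hφ : ∀ j : ℕ, ((φ j : ℕ) : ℤ) = (q + m * j) % n :=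
    fun j => Int.toNat_of_nonneg (Int.emod_nonneg _ hnz.ne')
  have hlt : ∀ j : ℕ, φ j < n := by
    intro j
    have := Int.emod_lt_of_pos (q + m * j) hnz
    rw [← hφ] at this
    exact_mod_cast this
  have hfr : ∀ j : ℕ, Int.fract (y + m * j / n) = (((φ j : ℕ) : ℝ) + r) / n := by
    intro j
    rw [Int.fract_eq_iff]
    refine ⟨by have := Int.fract_nonneg ((n : ℝ) * y); positivity, ?_, (q + m * j) / n, ?_⟩
    · rw [div_lt_one hn']
      have h1 : ((φ j : ℕ) : ℝ) + 1 ≤ n := by exact_mod_cast hlt j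
      have h2 := Int.fract_lt_one ((n : ℝ) * y)
      linarith
    · have h1 : ((φ j : ℕ) : ℝ) = q + m * j - n * (((q + m * j) / n : ℤ) : ℝ) := by
        have h2 : ((φ j : ℕ) : ℤ) = q + m * j - n * ((q + m * j) / n) := by
          rw [hφ, Int.emod_def]
        exact_mod_cast congrArg (fun z : ℤ => (z : ℝ)) h2
      rw [h1]
      field_simp
      linarith
  have hinj : Set.InjOn φ (Finset.range n) := by
    intro i hi j hj hij
    have h1 : (q + m * i) % n = (q + m * j) % (n : ℤ) := by rw [← hφ, ← hφ, hij]
    have h2 : (m * i : ℤ) ≡ m * j [ZMOD n] := Int.ModEq.add_left_cancel' q h1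
    have h3 : m * i ≡ m * j [MOD n] := by
      rw [← Int.natCast_modEq_iff]
      exact_mod_cast h2
    have h4 : i ≡ j [MOD n] := Nat.ModEq.cancel_left_of_coprime (Nat.coprime_comm.1 hmn) h3
    exact Nat.ModEq.eq_of_lt_of_lt h4 (Finset.mem_range.1 hi) (Finset.mem_range.1 hj)
  have himg : (Finset.range n).image φ = Finset.range n := by
    apply Finset.eq_of_subset_of_card_le
    · intro i hi
      obtain ⟨j, _, rfl⟩ := Finset.mem_image.1 hi
      exact Finset.mem_range.2 (hlt j)
    · rw [Finset.card_image_of_injOn hinj]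
  have hsum : ∑ j ∈ Finset.range n, centeredFractPow N (y + m * j / n)
      = ∑ i ∈ Finset.range n, ((((i : ℝ) + r) / n) ^ N - 1 / ((N : ℝ) + 1)) := by
    conv_rhs => rw [← himg]
    rw [Finset.sum_image hinj]
    exact Finset.sum_congr rfl fun j _ => by rw [centeredFractPow, hfr]
  rw [hsum]
  exact abs_sum_range_div_pow_sub_le N hn (Int.fract_nonneg _) (Int.fract_lt_one _)

theorem abs_sum_centeredFractPow_le_gcd (N : ℕ) (m : ℕ) {n : ℕ} (hn : 0 < n) (y : ℝ) :
    |∑ j ∈ Finset.range n, centeredFractPow N (y + m * j / n)| ≤ m.gcd n := by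
  obtain ⟨m', n', hcop, hm', hn'⟩ := Nat.exists_coprime m n
  set g := m.gcd n with hg
  have hg0 : 0 < g := Nat.gcd_pos_of_pos_right m hn
  have hn0 : 0 < n' := Nat.pos_of_ne_zero fun h => by simp [h] at hn'; omega
  have hn0' : (0 : ℝ) < n' := by exact_mod_cast hn0
  have hg0' : (0 : ℝ) < g := by exact_mod_cast hg0
  have key : ∀ k : ℕ,
      |∑ j ∈ Finset.range (k * n'), centeredFractPow N (y + m' * j / n')| ≤ k := by
    intro k
    induction k with
    | zero => simp
    | succ k ih =>
      rw [Nat.succ_mul, Finset.sum_range_add]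
      have hshift : ∀ b : ℕ, centeredFractPow N (y + m' * ((k * n' + b : ℕ) : ℝ) / n')
          = centeredFractPow N (y + m' * b / n') := by
        intro b
        rw [← centeredFractPow_add_nat N (y + m' * b / n') (m' * k)]
        congr 1
        push_cast
        field_simp
        ring
      simp only [hshift]
      push_cast
      exact (abs_add_le _ _).trans
        (add_le_add ih (abs_sum_centeredFractPow_le_one N hn0 hcop y))
  have hterm : ∀ j : ℕ, (m : ℝ) * j / n = m' * j / n' := by
    intro j
    have h1 : (m : ℝ) = m' * g := by exact_mod_cast hm'
    have h2 : (n : ℝ) = n' * g := by exact_mod_cast hn'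
    rw [h1, h2]
    field_simp
  simp only [hterm]
  have h := key g
  rwa [mul_comm g n', ← hn'] at h

theorem intervalIntegrable_of_measurable_of_abs_le {F : ℝ → ℝ} (hF : Measurable F) {C : ℝ}
    (hC : ∀ x, |F x| ≤ C) (s t : ℝ) : IntervalIntegrable F volume s t := by
  exact (intervalIntegrable_const (c := C)).mono_fun' hF.aestronglyMeasurable
    (Filter.Eventually.of_forall hC)

theorem measurable_centeredFractPow_mul (N : ℕ) (c : ℝ) :
    Measurable fun x => centeredFractPow N (c * x) :=
  (measurable_centeredFractPow N).comp (measurable_const_mul c)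

/-- Averaging the integrand over the translations by `j / n`, which fix the dilate by `n`,
replaces the dilate by `m` with an equidistributed sum of size at most `gcd(m, n)`. -/
theorem abs_integral_centeredFractPow_mul_le (N : ℕ) (m : ℕ) {n : ℕ} (hn : 0 < n) :
    |∫ x in (0 : ℝ)..1, centeredFractPow N (m * x) * centeredFractPow N (n * x)|
      ≤ (m.gcd n : ℝ) / n := by
  have hn' : (0 : ℝ) < n := by exact_mod_cast hn
  set F : ℝ → ℝ := fun x => centeredFractPow N (m * x) * centeredFractPow N (n * x) with hF
  have hFm : Measurable F :=
    (measurable_centeredFractPow_mul N m).mul (measurable_centeredFractPow_mul N n)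
  have hFb : ∀ x, |F x| ≤ 1 := fun x => by
    rw [hF, abs_mul]
    exact mul_le_one₀ (abs_centeredFractPow_le N _) (abs_nonneg _) (abs_centeredFractPow_le N _)
  have hper : Function.Periodic F 1 := by
    intro x
    simp only [hF, mul_add, mul_one, centeredFractPow_add_nat]
  have htrans : ∀ c : ℝ, ∫ x in (0 : ℝ)..1, F (x + c) = ∫ x in (0 : ℝ)..1, F x := by
    intro c
    rw [intervalIntegral.integral_comp_add_right, zero_add, add_comm (1 : ℝ) c]
    simpa using hper.intervalIntegral_add_eq c 0
  have hFj : ∀ (j : ℕ) (x : ℝ), F (x + j / n)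
      = centeredFractPow N (m * x + m * j / n) * centeredFractPow N (n * x) := by
    intro j x
    simp only [hF]
    rw [← centeredFractPow_add_nat N (n * x) j]
    congr 2 <;> field_simp
  have hsum : (n : ℝ) * ∫ x in (0 : ℝ)..1, F x
      = ∫ x in (0 : ℝ)..1, ∑ j ∈ Finset.range n, F (x + j / n) := by
    rw [intervalIntegral.integral_finsetSum]
    · simp only [htrans]
      simp
    · intro j _
      exact intervalIntegrable_of_measurable_of_abs_le
        (hFm.comp (measurable_add_const _)) (fun x => hFb _) 0 1
  have hbound : ‖∫ x in (0 : ℝ)..1, ∑ j ∈ Finset.range n, F (x + j / n)‖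
      ≤ (m.gcd n : ℝ) * |1 - 0| := by
    refine intervalIntegral.norm_integral_le_of_norm_le_const fun x _ => ?_
    simp only [hFj]
    rw [← Finset.sum_mul, Real.norm_eq_abs, abs_mul]
    calc _ ≤ (m.gcd n : ℝ) * 1 :=
          mul_le_mul (abs_sum_centeredFractPow_le_gcd N m hn _) (abs_centeredFractPow_le N _)
            (abs_nonneg _) (Nat.cast_nonneg _)
      _ = _ := mul_one _
  rw [← hsum, Real.norm_eq_abs, abs_mul, abs_of_pos hn'] at hbound
  rw [le_div_iff₀ hn']
  simpa [mul_comm] using hbound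

/-! ### Integrals over initial intervals -/

theorem intervalIntegrable_centeredFractPow (N : ℕ) (s t : ℝ) :
    IntervalIntegrable (centeredFractPow N) volume s t :=
  intervalIntegrable_of_measurable_of_abs_le (measurable_centeredFractPow N)
    (abs_centeredFractPow_le N) s t

theorem integral_centeredFractPow_of_mem {N : ℕ} {u : ℝ} (h0 : 0 ≤ u) (h1 : u ≤ 1) :
    ∫ x in (0 : ℝ)..u, centeredFractPow N x = -(u * (1 - u ^ N) / ((N : ℝ) + 1)) := by
  have hae : ∫ x in (0 : ℝ)..u, centeredFractPow N x
      = ∫ x in (0 : ℝ)..u, (x ^ N - 1 / ((N : ℝ) + 1)) := by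
    rw [intervalIntegral.integral_of_le h0, intervalIntegral.integral_of_le h0,
      integral_Ioc_eq_integral_Ioo, integral_Ioc_eq_integral_Ioo]
    refine setIntegral_congr_fun measurableSet_Ioo fun x hx => ?_
    rw [centeredFractPow, Int.fract_eq_self.2 ⟨hx.1.le, hx.2.trans_le h1⟩]
  rw [hae, intervalIntegral.integral_sub (by simp) (by simp), integral_pow]
  have : (N : ℝ) + 1 ≠ 0 := by positivity
  simp
  field_simp
  ring

/-- The primitive of `{x}^N - 1/(N+1)` vanishing at `0` is nowhere positive. -/
theorem integral_centeredFractPow_nonpos (N : ℕ) (u : ℝ) :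
    ∫ x in (0 : ℝ)..u, centeredFractPow N x ≤ 0 := by
  have hadd := (centeredFractPow_periodic N).intervalIntegral_add_zsmul_eq ⌊u⌋ (Int.fract u)
    (intervalIntegrable_centeredFractPow N)
  have hone : ∫ x in Int.fract u..Int.fract u + 1, centeredFractPow N x = 0 := by
    rw [(centeredFractPow_periodic N).intervalIntegral_add_eq (Int.fract u) 0, zero_add,
      integral_centeredFractPow_of_mem zero_le_one le_rfl]
    simp
  rw [hone, smul_zero, zsmul_one, Int.fract_add_floor] at hadd
  rw [← intervalIntegral.integral_add_adjacent_intervals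
    (intervalIntegrable_centeredFractPow N 0 (Int.fract u))
    (intervalIntegrable_centeredFractPow N _ u), hadd, add_zero,
    integral_centeredFractPow_of_mem (Int.fract_nonneg u) (Int.fract_lt_one u).le, neg_nonpos]
  have h1 := Int.fract_nonneg u
  have h2 := pow_le_one₀ (n := N) h1 (Int.fract_lt_one u).le
  have h3 : 0 ≤ 1 - Int.fract u ^ N := by linarith
  positivity

theorem integral_centeredFractPow_mul_nonpos (N : ℕ) {n : ℕ} (hn : 0 < n) (T : ℝ) :
    ∫ x in (0 : ℝ)..T, centeredFractPow N (n * x) ≤ 0 := by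
  have hn' : (0 : ℝ) < n := by exact_mod_cast hn
  rw [intervalIntegral.integral_comp_mul_left _ hn'.ne', mul_zero, smul_eq_mul]
  exact mul_nonpos_of_nonneg_of_nonpos (by positivity)
    (integral_centeredFractPow_nonpos N _)

theorem integral_centeredFractPow_mul_le {N : ℕ} (hN : 1 ≤ N) {n : ℕ} (hn : 0 < n) {T : ℝ}
    (hT : 0 ≤ T) (hnT : n * T ≤ 1 / 2) :
    ∫ x in (0 : ℝ)..T, centeredFractPow N (n * x) ≤ -(T / (2 * ((N : ℝ) + 1))) := by
  have hn' : (0 : ℝ) < n := by exact_mod_cast hn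
  have h0 : 0 ≤ n * T := by positivity
  rw [intervalIntegral.integral_comp_mul_left _ hn'.ne', mul_zero, smul_eq_mul,
    integral_centeredFractPow_of_mem h0 (by linarith), mul_neg, neg_le_neg_iff]
  have h1 : (n * T) ^ N ≤ 1 / 2 :=
    (pow_le_of_le_one h0 (by linarith) (by omega)).trans hnT
  have hN' : (0 : ℝ) < (N : ℝ) + 1 := by positivity
  calc T / (2 * ((N : ℝ) + 1)) = T / (N + 1) * (1 / 2) := by field_simp
    _ ≤ T / (N + 1) * (1 - (n * T) ^ N) := by gcongr; linarith
    _ = (n : ℝ)⁻¹ * (n * T * (1 - (n * T) ^ N) / (N + 1)) := by field_simp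

/-! ### Growth of the coefficients -/

/-- A monotone coefficient is at most a constant times the average of the coefficients over
`[n, 2n)`, so summability at the exponent `9/8` gives the bound `O(n^{1/8})`. -/
theorem exists_le_mul_rpow_of_lseriesSummable {a : ℝ → ℝ} (ha0 : ∀ t : ℝ, 1 ≤ t → 0 ≤ a t)
    (ham : MonotoneOn a (Set.Ici 1))
    (hs : LSeriesSummable (fun n : ℕ => ((a (n : ℝ) : ℝ) : ℂ)) ((9 / 8 : ℝ) : ℂ)) :
    ∃ K : ℝ, 0 ≤ K ∧ ∀ n : ℕ, 1 ≤ n → a n ≤ K * (n : ℝ) ^ (1 / 8 : ℝ) := by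
  set u : ℕ → ℝ :=
    fun n => ‖LSeries.term (fun n : ℕ => ((a (n : ℝ) : ℝ) : ℂ)) ((9 / 8 : ℝ) : ℂ) n‖ with hu
  have hsum : Summable u := hs.norm
  have hu1 : ∀ n : ℕ, 1 ≤ n → u n = a n / (n : ℝ) ^ (9 / 8 : ℝ) := by
    intro n hn
    rw [hu]
    simp only [LSeries.norm_term_eq, Complex.ofReal_re, if_neg (show n ≠ 0 by omega),
      Complex.norm_real, Real.norm_of_nonneg (ha0 n (by exact_mod_cast hn))]
  refine ⟨(∑' n, u n) * 2 ^ (9 / 8 : ℝ), mul_nonneg (tsum_nonneg fun n => norm_nonneg _)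
    (by positivity), fun n hn => ?_⟩
  have hn' : (1 : ℝ) ≤ n := by exact_mod_cast hn
  have hn0 : (0 : ℝ) < n := by linarith
  have h1 : ∑ k ∈ Finset.Ico n (2 * n), u k ≤ ∑' n, u n :=
    hsum.sum_le_tsum _ fun i _ => norm_nonneg _
  have h2 : ∑ _k ∈ Finset.Ico n (2 * n), a n / (2 * (n : ℝ)) ^ (9 / 8 : ℝ)
      ≤ ∑ k ∈ Finset.Ico n (2 * n), u k := by
    refine Finset.sum_le_sum fun k hk => ?_
    obtain ⟨hk1, hk2⟩ := Finset.mem_Ico.1 hk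
    have hnk : (n : ℝ) ≤ k := by exact_mod_cast hk1
    have hk2' : (k : ℝ) ≤ 2 * n := by exact_mod_cast hk2.le
    rw [hu1 k (hn.trans hk1)]
    have h3 : a n ≤ a k := ham hn' (Set.mem_Ici.2 (hn'.trans hnk)) hnk
    have h4 : 0 < (k : ℝ) := by linarith
    exact div_le_div₀ ((ha0 n hn').trans h3) h3 (by positivity)
      (Real.rpow_le_rpow h4.le hk2' (by norm_num))
  have h3 := h2.trans h1
  rw [Finset.sum_const, Nat.card_Ico, nsmul_eq_mul, show 2 * n - n = n by omega,
    Real.mul_rpow (by norm_num) hn0.le, show (9 / 8 : ℝ) = 1 + 1 / 8 by norm_num,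
    Real.rpow_add hn0, Real.rpow_one] at h3
  rw [show (9 / 8 : ℝ) = 1 + 1 / 8 by norm_num]
  have h4 : (0 : ℝ) < 2 ^ (1 + 1 / 8 : ℝ) := by positivity
  have h5 : (0 : ℝ) < (n : ℝ) ^ (1 / 8 : ℝ) := by positivity
  have h6 : (n : ℝ) * (a n / (2 ^ (1 + 1 / 8 : ℝ) * (n * (n : ℝ) ^ (1 / 8 : ℝ))))
      = a n / (2 ^ (1 + 1 / 8 : ℝ) * (n : ℝ) ^ (1 / 8 : ℝ)) := by
    field_simp
  rw [h6, div_le_iff₀ (by positivity)] at h3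
  linarith

theorem le_mul_rpow_of_sq {a : ℝ → ℝ} {K : ℝ} (hK0 : 0 ≤ K)
    (hK : ∀ n : ℕ, 1 ≤ n → a n ≤ K * (n : ℝ) ^ (1 / 8 : ℝ)) {k : ℕ} (hk : 1 ≤ k) :
    a (((k + 1) ^ 2 : ℕ) : ℝ) ≤ 2 * K * (k : ℝ) ^ (1 / 4 : ℝ) := by
  have hk' : (1 : ℝ) ≤ k := by exact_mod_cast hk
  have h1 : ((((k + 1) ^ 2 : ℕ) : ℝ)) ^ (1 / 8 : ℝ) ≤ 2 * (k : ℝ) ^ (1 / 4 : ℝ) := by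
    calc ((((k + 1) ^ 2 : ℕ) : ℝ)) ^ (1 / 8 : ℝ) ≤ ((2 * (k : ℝ)) ^ (2 : ℝ)) ^ (1 / 8 : ℝ) := by
          refine Real.rpow_le_rpow (by positivity) ?_ (by norm_num)
          rw [Real.rpow_two]
          push_cast
          gcongr
          linarith
      _ = (2 : ℝ) ^ (1 / 4 : ℝ) * (k : ℝ) ^ (1 / 4 : ℝ) := by
          rw [← Real.rpow_mul (by positivity), Real.mul_rpow (by norm_num) (by linarith)]
          norm_num
      _ ≤ 2 * (k : ℝ) ^ (1 / 4 : ℝ) := by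
          gcongr
          calc (2 : ℝ) ^ (1 / 4 : ℝ) ≤ (2 : ℝ) ^ (1 : ℝ) :=
                Real.rpow_le_rpow_of_exponent_le (by norm_num) (by norm_num)
            _ = 2 := Real.rpow_one 2
  calc a (((k + 1) ^ 2 : ℕ) : ℝ) ≤ K * ((((k + 1) ^ 2 : ℕ) : ℝ)) ^ (1 / 8 : ℝ) :=
        hK _ (Nat.one_le_pow _ _ (by omega))
    _ ≤ K * (2 * (k : ℝ) ^ (1 / 4 : ℝ)) := by gcongr
    _ = _ := by ring

theorem coeff_le_of_mem_block {a : ℝ → ℝ} (ha0 : ∀ t : ℝ, 1 ≤ t → 0 ≤ a t)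
    (ham : MonotoneOn a (Set.Ici 1)) {k : ℕ} (hk : 1 ≤ k) {n : ℕ}
    (hn : n ∈ Finset.Ioc (k ^ 2) ((k + 1) ^ 2)) :
    |a n / n| ≤ a (((k + 1) ^ 2 : ℕ) : ℝ) / (k : ℝ) ^ 2 := by
  obtain ⟨h1, h2⟩ := Finset.mem_Ioc.1 hn
  have hk2 : 1 ≤ k ^ 2 := Nat.one_le_pow _ _ hk
  have hn1 : (1 : ℝ) ≤ n := by exact_mod_cast hk2.trans h1.le
  have h2' : (n : ℝ) ≤ (((k + 1) ^ 2 : ℕ) : ℝ) := by exact_mod_cast h2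
  have h1' : (k : ℝ) ^ 2 ≤ n := by exact_mod_cast h1.le
  have hk' : (0 : ℝ) < k := by exact_mod_cast hk
  have h3 := ham hn1 (Set.mem_Ici.2 (hn1.trans h2')) h2'
  have h4 := ha0 n hn1
  rw [abs_of_nonneg (by positivity)]
  exact div_le_div₀ (h4.trans h3) h3 (by positivity) h1'

/-! ### Blocks between consecutive squares -/

/-- The part of the series with `k² < n ≤ (k+1)²`. -/
noncomputable def davenportBlock (a : ℝ → ℝ) (N k : ℕ) (x : ℝ) : ℝ :=
  ∑ n ∈ Finset.Ioc (k ^ 2) ((k + 1) ^ 2), a n / n * centeredFractPow N (n * x)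

theorem card_block (k : ℕ) : ((Finset.Ioc (k ^ 2) ((k + 1) ^ 2)).card : ℝ) = 2 * k + 1 := by
  rw [Nat.card_Ioc, Nat.cast_sub (Nat.pow_le_pow_left (by omega) 2)]
  push_cast
  ring

theorem measurable_davenportBlock (a : ℝ → ℝ) (N k : ℕ) : Measurable (davenportBlock a N k) :=
  Finset.measurable_fun_sum _ fun n _ => (measurable_centeredFractPow_mul N n).const_mul _

theorem abs_davenportBlock_le (a : ℝ → ℝ) (N k : ℕ) (x : ℝ) :
    |davenportBlock a N k x| ≤ ∑ n ∈ Finset.Ioc (k ^ 2) ((k + 1) ^ 2), |a n / n| := by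
  refine (Finset.abs_sum_le_sum_abs _ _).trans (Finset.sum_le_sum fun n _ => ?_)
  rw [abs_mul]
  exact mul_le_of_le_one_right (abs_nonneg _) (abs_centeredFractPow_le N _)

theorem integrable_davenportBlock (a : ℝ → ℝ) (N k : ℕ) (T : ℝ) :
    Integrable (davenportBlock a N k) (volume.restrict (Set.Ioc 0 T)) :=
  Integrable.of_bound (measurable_davenportBlock a N k).aestronglyMeasurable _
    (Filter.Eventually.of_forall (abs_davenportBlock_le a N k))

/-- Distinct indices in one block differ by at most `2k`, which bounds their greatest common
divisor; this is why blocks between consecutive squares need no divisor estimates. -/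
theorem gcd_div_le_of_mem_block {k : ℕ} (hk : 1 ≤ k) {m n : ℕ}
    (hm : m ∈ Finset.Ioc (k ^ 2) ((k + 1) ^ 2)) (hn : n ∈ Finset.Ioc (k ^ 2) ((k + 1) ^ 2)) :
    (m.gcd n : ℝ) / n ≤ (if m = n then 1 else 0) + 2 / k := by
  obtain ⟨hm1, hm2⟩ := Finset.mem_Ioc.1 hm
  obtain ⟨hn1, hn2⟩ := Finset.mem_Ioc.1 hn
  have hk' : (0 : ℝ) < k := by exact_mod_cast hk
  have hn' : (k : ℝ) ^ 2 ≤ n := by exact_mod_cast hn1.le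
  have hn0 : (0 : ℝ) < n := by nlinarith
  have hexp : (k + 1) ^ 2 = k ^ 2 + 2 * k + 1 := by ring
  rw [hexp] at hm2 hn2
  split_ifs with h
  · rw [h, Nat.gcd_self, div_self hn0.ne']
    have : (0 : ℝ) ≤ 2 / k := by positivity
    linarith
  · have hg : m.gcd n ≤ 2 * k := by
      rcases lt_or_gt_of_ne h with h' | h'
      · have := Nat.le_of_dvd (by omega)
          (Nat.dvd_sub (Nat.gcd_dvd_right m n) (Nat.gcd_dvd_left m n))
        omega
      · have := Nat.le_of_dvd (by omega)
          (Nat.dvd_sub (Nat.gcd_dvd_left m n) (Nat.gcd_dvd_right m n))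
        omega
    have hg' : (m.gcd n : ℝ) ≤ 2 * k := by exact_mod_cast hg
    calc (m.gcd n : ℝ) / n ≤ 2 * k / (k : ℝ) ^ 2 :=
          div_le_div₀ (by positivity) hg' (by positivity) hn'
      _ = 0 + 2 / k := by field_simp; ring

theorem integral_davenportBlock_sq_le {a : ℝ → ℝ} (ha0 : ∀ t : ℝ, 1 ≤ t → 0 ≤ a t)
    (ham : MonotoneOn a (Set.Ici 1)) (N : ℕ) {k : ℕ} (hk : 1 ≤ k) :
    ∫ x in (0 : ℝ)..1, davenportBlock a N k x ^ 2
      ≤ 21 * a (((k + 1) ^ 2 : ℕ) : ℝ) ^ 2 / (k : ℝ) ^ 3 := by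
  have hk' : (1 : ℝ) ≤ k := by exact_mod_cast hk
  set s := Finset.Ioc (k ^ 2) ((k + 1) ^ 2) with hs
  set A := a (((k + 1) ^ 2 : ℕ) : ℝ) / (k : ℝ) ^ 2 with hA
  have hA0 : 0 ≤ A := by
    have h := ha0 (((k + 1) ^ 2 : ℕ) : ℝ) (by exact_mod_cast Nat.one_le_pow _ _ (by omega))
    positivity
  have hexpand : ∀ x, davenportBlock a N k x ^ 2 = ∑ m ∈ s, ∑ n ∈ s,
      (a m / m * (a n / n)) * (centeredFractPow N (m * x) * centeredFractPow N (n * x)) := by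
    intro x
    rw [davenportBlock, sq, Finset.sum_mul_sum]
    refine Finset.sum_congr rfl fun m _ => Finset.sum_congr rfl fun n _ => ?_
    ring
  have hint : ∀ m n : ℕ, IntervalIntegrable (fun x => (a m / m * (a n / n)) *
      (centeredFractPow N (m * x) * centeredFractPow N (n * x))) volume 0 1 := by
    intro m n
    refine (intervalIntegrable_of_measurable_of_abs_le (C := 1)
      ((measurable_centeredFractPow_mul N m).mul (measurable_centeredFractPow_mul N n))
      (fun x => ?_) 0 1).const_mul _
    rw [Pi.mul_apply, abs_mul]
    exact mul_le_one₀ (abs_centeredFractPow_le N _) (abs_nonneg _) (abs_centeredFractPow_le N _)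
  have hint' : ∀ m : ℕ, IntervalIntegrable (fun x => ∑ n ∈ s, (a m / m * (a n / n)) *
      (centeredFractPow N (m * x) * centeredFractPow N (n * x))) volume 0 1 := by
    intro m
    have h := IntervalIntegrable.sum s fun n _ => hint m n
    rwa [Finset.sum_fn] at h
  simp only [hexpand]
  rw [intervalIntegral.integral_finsetSum fun m _ => hint' m]
  have hterm : ∀ m ∈ s, ∀ n ∈ s, ∫ x in (0 : ℝ)..1, (a m / m * (a n / n)) *
      (centeredFractPow N (m * x) * centeredFractPow N (n * x))
      ≤ A ^ 2 * ((if m = n then 1 else 0) + 2 / k) := by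
    intro m hm n hn
    have hn0 : 0 < n := by have := (Finset.mem_Ioc.1 hn).1; omega
    rw [intervalIntegral.integral_const_mul]
    refine (le_abs_self _).trans ?_
    rw [abs_mul, abs_mul, sq A]
    have h1 := (abs_integral_centeredFractPow_mul_le N m hn0).trans
      (gcd_div_le_of_mem_block hk hm hn)
    exact mul_le_mul (mul_le_mul (coeff_le_of_mem_block ha0 ham hk hm)
      (coeff_le_of_mem_block ha0 ham hk hn) (abs_nonneg _) hA0) h1 (abs_nonneg _) (by positivity)
  have hbound : ∑ m ∈ s, ∫ x in (0 : ℝ)..1, ∑ n ∈ s, (a m / m * (a n / n)) *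
      (centeredFractPow N (m * x) * centeredFractPow N (n * x))
      ≤ ∑ m ∈ s, ∑ n ∈ s, A ^ 2 * ((if m = n then 1 else 0) + 2 / k) := by
    refine Finset.sum_le_sum fun m hm => ?_
    rw [intervalIntegral.integral_finsetSum fun n _ => hint m n]
    exact Finset.sum_le_sum fun n hn => hterm m hm n hn
  refine hbound.trans ?_
  have hcount : ∑ m ∈ s, ∑ n ∈ s, A ^ 2 * ((if m = n then (1 : ℝ) else 0) + 2 / k)
      = A ^ 2 * ((2 * k + 1) + (2 * k + 1) * ((2 * k + 1) * (2 / k))) := by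
    simp only [← Finset.mul_sum, Finset.sum_add_distrib, Finset.sum_const, nsmul_eq_mul,
      Finset.sum_ite_eq]
    rw [Finset.sum_congr rfl fun m hm => if_pos hm]
    simp only [Finset.sum_const, nsmul_eq_mul, hs, card_block, mul_one]
  rw [hcount]
  calc A ^ 2 * ((2 * k + 1) + (2 * k + 1) * ((2 * k + 1) * (2 / k)))
      ≤ A ^ 2 * (3 * k + 3 * k * (3 * k * (2 / k))) := by gcongr <;> linarith
    _ = 21 * a (((k + 1) ^ 2 : ℕ) : ℝ) ^ 2 / (k : ℝ) ^ 3 := by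
        rw [hA]
        field_simp
        ring

theorem integral_abs_davenportBlock_le {a : ℝ → ℝ} (ha0 : ∀ t : ℝ, 1 ≤ t → 0 ≤ a t)
    (ham : MonotoneOn a (Set.Ici 1)) {K : ℝ} (hK0 : 0 ≤ K)
    (hK : ∀ n : ℕ, 1 ≤ n → a n ≤ K * (n : ℝ) ^ (1 / 8 : ℝ)) (N : ℕ) {k : ℕ} (hk : 1 ≤ k) :
    ∫ x in (0 : ℝ)..1, |davenportBlock a N k x|
      ≤ (1 + 84 * K ^ 2) * (k : ℝ) ^ (-(5 / 4) : ℝ) := by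
  have hk' : (0 : ℝ) < k := by exact_mod_cast hk
  have hm := measurable_davenportBlock a N k
  have hb := abs_davenportBlock_le a N k
  set D := ∑ n ∈ Finset.Ioc (k ^ 2) ((k + 1) ^ 2), |a n / n|
  have hi1 : IntervalIntegrable (fun x => |davenportBlock a N k x|) volume 0 1 :=
    intervalIntegrable_of_measurable_of_abs_le (by fun_prop) (C := D)
      (fun x => by rw [abs_abs]; exact hb x) 0 1
  have hi2 : IntervalIntegrable (fun x => davenportBlock a N k x ^ 2) volume 0 1 :=
    intervalIntegrable_of_measurable_of_abs_le (by fun_prop) (C := D ^ 2)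
      (fun x => by rw [abs_pow]; exact pow_le_pow_left₀ (abs_nonneg _) (hb x) 2) 0 1
  -- The weight `k^{5/4}` balances the two terms, the mean square being `O(k^{-5/2})`.
  set w := (k : ℝ) ^ (5 / 4 : ℝ) with hw
  have hw0 : 0 < w := by positivity
  have hpt : ∀ x, |davenportBlock a N k x| ≤ w⁻¹ + w * davenportBlock a N k x ^ 2 := by
    intro x
    rw [← sq_abs (davenportBlock a N k x)]
    set b := |davenportBlock a N k x|
    have h1 : 0 ≤ w⁻¹ * ((w * b - 1) ^ 2 + w * b) := by positivity
    have h2 : w⁻¹ * ((w * b - 1) ^ 2 + w * b) = w⁻¹ + w * b ^ 2 - b := by field_simp; ring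
    linarith
  have h1 : ∫ x in (0 : ℝ)..1, |davenportBlock a N k x|
      ≤ ∫ x in (0 : ℝ)..1, (w⁻¹ + w * davenportBlock a N k x ^ 2) :=
    intervalIntegral.integral_mono_on zero_le_one hi1
      ((intervalIntegrable_const).add (hi2.const_mul w)) fun x _ => hpt x
  rw [intervalIntegral.integral_add intervalIntegrable_const (hi2.const_mul w),
    intervalIntegral.integral_const_mul, intervalIntegral.integral_const] at h1
  have hA0 := ha0 (((k + 1) ^ 2 : ℕ) : ℝ) (by exact_mod_cast Nat.one_le_pow _ _ (by omega))
  have h2 : ∫ x in (0 : ℝ)..1, davenportBlock a N k x ^ 2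
      ≤ 84 * K ^ 2 * (w⁻¹ * w⁻¹) := by
    calc _ ≤ 21 * a (((k + 1) ^ 2 : ℕ) : ℝ) ^ 2 / (k : ℝ) ^ 3 :=
          integral_davenportBlock_sq_le ha0 ham N hk
      _ ≤ 21 * (2 * K * (k : ℝ) ^ (1 / 4 : ℝ)) ^ 2 / (k : ℝ) ^ 3 := by
          gcongr
          exact le_mul_rpow_of_sq hK0 hK hk
      _ = 84 * K ^ 2 * (((k : ℝ) ^ (1 / 4 : ℝ) * (k : ℝ) ^ (1 / 4 : ℝ)) * ((k : ℝ) ^ 3)⁻¹) := by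
          ring
      _ = 84 * K ^ 2 * (w⁻¹ * w⁻¹) := by
          rw [hw, ← Real.rpow_neg hk'.le, ← Real.rpow_add hk', ← Real.rpow_add hk',
            ← Real.rpow_natCast (k : ℝ) 3, ← Real.rpow_neg hk'.le, ← Real.rpow_add hk']
          norm_num
  have h3 : w * ∫ x in (0 : ℝ)..1, davenportBlock a N k x ^ 2 ≤ 84 * K ^ 2 * w⁻¹ := by
    calc _ ≤ w * (84 * K ^ 2 * (w⁻¹ * w⁻¹)) := by gcongr
      _ = _ := by field_simp
  rw [Real.rpow_neg hk'.le, ← hw]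
  simp only [sub_zero, one_smul] at h1
  linarith

theorem summable_integral_norm_davenportBlock {a : ℝ → ℝ} (ha0 : ∀ t : ℝ, 1 ≤ t → 0 ≤ a t)
    (ham : MonotoneOn a (Set.Ici 1)) {K : ℝ} (hK0 : 0 ≤ K)
    (hK : ∀ n : ℕ, 1 ≤ n → a n ≤ K * (n : ℝ) ^ (1 / 8 : ℝ)) (N : ℕ) {T : ℝ} (hT : T ≤ 1) :
    Summable fun k => ∫ x in Set.Ioc 0 T, ‖davenportBlock a N k x‖ := by
  have hs : Summable fun k : ℕ => (1 + 84 * K ^ 2) * (k : ℝ) ^ (-(5 / 4) : ℝ) :=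
    (Real.summable_nat_rpow.2 (by norm_num)).mul_left _
  refine Summable.of_norm_bounded_eventually_nat hs ?_
  filter_upwards [eventually_ge_atTop 1] with k hk
  rw [Real.norm_of_nonneg (integral_nonneg fun x => norm_nonneg _)]
  refine le_trans ?_ (integral_abs_davenportBlock_le ha0 ham hK0 hK N hk)
  rw [intervalIntegral.integral_of_le zero_le_one]
  exact setIntegral_mono_set (integrable_davenportBlock a N k 1).norm
    (Filter.Eventually.of_forall fun x => norm_nonneg _)
    (Set.Ioc_subset_Ioc_right hT).eventuallyLE

/-! ### Convergence of the series -/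

theorem ae_summable_davenportBlock {a : ℝ → ℝ} (ha0 : ∀ t : ℝ, 1 ≤ t → 0 ≤ a t)
    (ham : MonotoneOn a (Set.Ici 1)) {K : ℝ} (hK0 : 0 ≤ K)
    (hK : ∀ n : ℕ, 1 ≤ n → a n ≤ K * (n : ℝ) ^ (1 / 8 : ℝ)) (N : ℕ) :
    ∀ᵐ x ∂(volume.restrict (Set.Ioc (0 : ℝ) 1)),
      Summable fun k => davenportBlock a N k x := by
  have h := summable_norm_of_tsum_eLpNorm_ne_top (μ := volume.restrict (Set.Ioc (0 : ℝ) 1))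
    le_rfl (fun k => (measurable_davenportBlock a N k).aestronglyMeasurable) (by
      have hL : ∀ k, eLpNorm (davenportBlock a N k) 1 (volume.restrict (Set.Ioc (0 : ℝ) 1))
          = ENNReal.ofReal (∫ x in Set.Ioc (0 : ℝ) 1, ‖davenportBlock a N k x‖) := by
        intro k
        rw [eLpNorm_one_eq_lintegral_enorm,
          ofReal_integral_norm_eq_lintegral_enorm (integrable_davenportBlock a N k 1)]
      simp only [hL]
      exact (summable_integral_norm_davenportBlock ha0 ham hK0 hK N le_rfl).tsum_ofReal_ne_top)
  filter_upwards [h] with x hx using hx.of_norm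

theorem sum_range_davenportBlock (a : ℝ → ℝ) (N k : ℕ) (x : ℝ) :
    ∑ j ∈ Finset.range k, davenportBlock a N j x
      = ∑ n ∈ Finset.Ioc 0 (k ^ 2), a n / n * centeredFractPow N (n * x) := by
  induction k with
  | zero => simp
  | succ k ih =>
    rw [Finset.sum_range_succ, ih, davenportBlock,
      Finset.sum_Ioc_consecutive _ (Nat.zero_le _) (Nat.pow_le_pow_left (by omega) 2)]

/-- Since a whole block has total mass tending to zero, convergence of the series of blocks gives
convergence of all partial sums. -/
theorem tendsto_davenportPartialSum {a : ℝ → ℝ} (ha0 : ∀ t : ℝ, 1 ≤ t → 0 ≤ a t)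
    (ham : MonotoneOn a (Set.Ici 1)) {K : ℝ} (hK0 : 0 ≤ K)
    (hK : ∀ n : ℕ, 1 ≤ n → a n ≤ K * (n : ℝ) ^ (1 / 8 : ℝ)) {N : ℕ} (hN : 1 ≤ N) {x : ℝ}
    (hx : Summable fun k => davenportBlock a N k x) :
    Tendsto (davenportPartialSum a N x) atTop (𝓝 (∑' k, davenportBlock a N k x)) := by
  have hsqrt : Tendsto Nat.sqrt atTop atTop := by
    refine tendsto_atTop.2 fun b => ?_
    filter_upwards [eventually_ge_atTop (b ^ 2)] with M hM using Nat.le_sqrt'.2 hM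
  have h1 : Tendsto (fun M : ℕ => ∑ j ∈ Finset.range M.sqrt, davenportBlock a N j x) atTop
      (𝓝 (∑' k, davenportBlock a N k x)) := hx.hasSum.tendsto_sum_nat.comp hsqrt
  have h2 : Tendsto (fun M : ℕ => davenportPartialSum a N x M
      - ∑ j ∈ Finset.range M.sqrt, davenportBlock a N j x) atTop (𝓝 0) := by
    have hlim : Tendsto (fun M : ℕ => 6 * K * ((M.sqrt : ℕ) : ℝ) ^ (-(3 / 4) : ℝ)) atTop
        (𝓝 0) := by
      have h := ((tendsto_rpow_neg_atTop (show (0 : ℝ) < 3 / 4 by norm_num)).comp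
        (tendsto_natCast_atTop_atTop (R := ℝ))).comp hsqrt
      simpa using h.const_mul (6 * K)
    refine squeeze_zero_norm' ?_ hlim
    filter_upwards [eventually_ge_atTop 1] with M hM
    set k := M.sqrt with hk
    have hk1 : 1 ≤ k := Nat.sqrt_pos.2 hM
    have hk1' : (1 : ℝ) ≤ k := by exact_mod_cast hk1
    have hkM : k ^ 2 ≤ M := Nat.sqrt_le' M
    have hMk : M ≤ (k + 1) ^ 2 := (Nat.lt_succ_sqrt' M).le
    have hIcc : Finset.Icc 1 M = Finset.Ioc 0 M := by
      ext n
      simp [Finset.mem_Icc, Finset.mem_Ioc, Nat.succ_le_iff]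
    rw [davenportPartialSum_eq a hN, sum_range_davenportBlock, hIcc,
      ← Finset.sum_Ioc_consecutive _ (Nat.zero_le (k ^ 2)) hkM, add_sub_cancel_left,
      Real.norm_eq_abs]
    have hA0 := ha0 (((k + 1) ^ 2 : ℕ) : ℝ) (by exact_mod_cast Nat.one_le_pow _ _ (by omega))
    calc |∑ n ∈ Finset.Ioc (k ^ 2) M, a n / n * centeredFractPow N (n * x)|
        ≤ ∑ n ∈ Finset.Ioc (k ^ 2) M, |a n / n| := by
          refine (Finset.abs_sum_le_sum_abs _ _).trans (Finset.sum_le_sum fun n _ => ?_)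
          rw [abs_mul]
          exact mul_le_of_le_one_right (abs_nonneg _) (abs_centeredFractPow_le N _)
      _ ≤ ∑ n ∈ Finset.Ioc (k ^ 2) ((k + 1) ^ 2), |a n / n| :=
          Finset.sum_le_sum_of_subset_of_nonneg (Finset.Ioc_subset_Ioc_right hMk)
            fun n _ _ => abs_nonneg _
      _ ≤ ∑ _n ∈ Finset.Ioc (k ^ 2) ((k + 1) ^ 2), a (((k + 1) ^ 2 : ℕ) : ℝ) / (k : ℝ) ^ 2 :=
          Finset.sum_le_sum fun n hn => coeff_le_of_mem_block ha0 ham hk1 hn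
      _ = (2 * k + 1) * (a (((k + 1) ^ 2 : ℕ) : ℝ) / (k : ℝ) ^ 2) := by
          rw [Finset.sum_const, nsmul_eq_mul, card_block]
      _ ≤ (3 * k) * (2 * K * (k : ℝ) ^ (1 / 4 : ℝ) / (k : ℝ) ^ 2) := by
          gcongr
          · linarith
          · exact le_mul_rpow_of_sq hK0 hK hk1
      _ = 6 * K * ((k : ℝ) ^ (1 / 4 : ℝ) * (k : ℝ)⁻¹) := by field_simp; ring
      _ = 6 * K * (k : ℝ) ^ (-(3 / 4) : ℝ) := by
          rw [← Real.rpow_neg_one (k : ℝ), ← Real.rpow_add (by linarith)]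
          norm_num
  simpa using h2.add h1

theorem hasSum_integral_davenportBlock {a : ℝ → ℝ} (ha0 : ∀ t : ℝ, 1 ≤ t → 0 ≤ a t)
    (ham : MonotoneOn a (Set.Ici 1)) {K : ℝ} (hK0 : 0 ≤ K)
    (hK : ∀ n : ℕ, 1 ≤ n → a n ≤ K * (n : ℝ) ^ (1 / 8 : ℝ)) (N : ℕ) {T : ℝ} (hT : T ≤ 1) :
    HasSum (fun k => ∫ x in Set.Ioc 0 T, davenportBlock a N k x)
      (∫ x in Set.Ioc 0 T, ∑' k, davenportBlock a N k x) :=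
  hasSum_integral_of_summable_integral_norm (fun k => integrable_davenportBlock a N k T)
    (summable_integral_norm_davenportBlock ha0 ham hK0 hK N hT)

/-! ### Unboundedness near the origin -/

theorem eventually_lt_sum_coeff {a : ℝ → ℝ} (ha0 : ∀ t : ℝ, 1 ≤ t → 0 ≤ a t)
    (ham : MonotoneOn a (Set.Ici 1)) (hane : ∃ n : ℕ, 1 ≤ n ∧ a (n : ℝ) ≠ 0) (B : ℝ) :
    ∀ᶠ M : ℕ in atTop, B < ∑ n ∈ Finset.Ioc 0 M, a n / n := by
  obtain ⟨n₀, hn₀, hne⟩ := hane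
  have hn₀' : (1 : ℝ) ≤ n₀ := by exact_mod_cast hn₀
  have hpos : 0 < a n₀ := (ha0 n₀ hn₀').lt_of_ne' hne
  -- Nothing is known about `a 0`, so the series is shifted by one.
  set u : ℕ → ℝ := fun n => a ((n + 1 : ℕ) : ℝ) / ((n + 1 : ℕ) : ℝ) with hu
  have hu0 : ∀ n, 0 ≤ u n := fun n =>
    div_nonneg (ha0 _ (by exact_mod_cast Nat.succ_le_succ (Nat.zero_le n))) (Nat.cast_nonneg _)
  have hns : ¬ Summable u := by
    intro hs
    refine Real.not_summable_one_div_natCast ?_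
    rw [← summable_nat_add_iff 1]
    refine Summable.of_norm_bounded_eventually_nat (hs.mul_left (a n₀)⁻¹) ?_
    filter_upwards [eventually_ge_atTop n₀] with n hn
    have h1 : (n₀ : ℝ) ≤ ((n + 1 : ℕ) : ℝ) := by exact_mod_cast hn.trans (Nat.le_succ n)
    have h2 := ham hn₀' (Set.mem_Ici.2 (hn₀'.trans h1)) h1
    have h3 : (0 : ℝ) < ((n + 1 : ℕ) : ℝ) := by positivity
    rw [Real.norm_of_nonneg (by positivity), hu, ← mul_div_assoc]
    refine div_le_div_of_nonneg_right ?_ h3.le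
    rw [inv_mul_eq_div]
    exact (one_le_div hpos).2 h2
  have h := (not_summable_iff_tendsto_nat_atTop_of_nonneg hu0).1 hns
  filter_upwards [h.eventually_gt_atTop B] with M hM
  have hsum : ∑ n ∈ Finset.Ioc 0 M, a n / n = ∑ n ∈ Finset.range M, u n := by
    rw [Finset.range_eq_Ico, Finset.sum_Ico_add' (fun n : ℕ => a n / (n : ℝ)) 0 M 1]
    rfl
  rwa [hsum]

theorem setIntegral_davenportBlock (a : ℝ → ℝ) (N k : ℕ) {T : ℝ} (hT : 0 ≤ T) :
    ∫ x in Set.Ioc 0 T, davenportBlock a N k x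
      = ∑ n ∈ Finset.Ioc (k ^ 2) ((k + 1) ^ 2),
        a n / n * ∫ x in (0 : ℝ)..T, centeredFractPow N (n * x) := by
  rw [← intervalIntegral.integral_of_le hT]
  simp only [davenportBlock]
  rw [intervalIntegral.integral_finsetSum]
  · simp only [intervalIntegral.integral_const_mul]
  · intro n _
    exact (intervalIntegrable_of_measurable_of_abs_le (measurable_centeredFractPow_mul N n)
      (fun x => abs_centeredFractPow_le N _) 0 T).const_mul _

/-- Every term of the series has nonpositive integral over `[0, T]`, and the terms with
`n T ≤ 1/2` contribute a fixed multiple of `-T a(n)/n`. -/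
theorem setIntegral_tsum_davenportBlock_le {a : ℝ → ℝ} (ha0 : ∀ t : ℝ, 1 ≤ t → 0 ≤ a t)
    (ham : MonotoneOn a (Set.Ici 1)) {K : ℝ} (hK0 : 0 ≤ K)
    (hK : ∀ n : ℕ, 1 ≤ n → a n ≤ K * (n : ℝ) ^ (1 / 8 : ℝ)) {N : ℕ} (hN : 1 ≤ N) {T : ℝ}
    (hT0 : 0 ≤ T) (hT : T ≤ 1) {R : ℕ} (hR : (R : ℝ) ^ 2 * T ≤ 1 / 2) :
    ∫ x in Set.Ioc 0 T, ∑' k, davenportBlock a N k x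
      ≤ -(T / (2 * ((N : ℝ) + 1)) * ∑ n ∈ Finset.Ioc 0 (R ^ 2), a n / n) := by
  have hc : ∀ n : ℕ, 0 < n → 0 ≤ a n / n := fun n hn =>
    div_nonneg (ha0 n (by exact_mod_cast hn)) (Nat.cast_nonneg n)
  have h := (hasSum_integral_davenportBlock ha0 ham hK0 hK N hT).neg
  have hle := sum_le_hasSum (Finset.range R) (fun k _ => by
    rw [setIntegral_davenportBlock a N k hT0, neg_nonneg]
    refine Finset.sum_nonpos fun n hn => ?_
    have hn0 : 0 < n := by have := (Finset.mem_Ioc.1 hn).1; omega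
    exact mul_nonpos_of_nonneg_of_nonpos (hc n hn0)
      (integral_centeredFractPow_mul_nonpos N hn0 T)) h
  have hpart : T / (2 * ((N : ℝ) + 1)) * ∑ n ∈ Finset.Ioc 0 (R ^ 2), a n / n
      ≤ ∑ k ∈ Finset.range R, -∫ x in Set.Ioc 0 T, davenportBlock a N k x := by
    rw [Finset.sum_neg_distrib, ← integral_finsetSum _ fun k _ =>
      integrable_davenportBlock a N k T, ← intervalIntegral.integral_of_le hT0]
    simp only [sum_range_davenportBlock]
    rw [intervalIntegral.integral_finsetSum]
    · simp only [intervalIntegral.integral_const_mul]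
      rw [← Finset.sum_neg_distrib, Finset.mul_sum]
      refine Finset.sum_le_sum fun n hn => ?_
      obtain ⟨hn0, hn1⟩ := Finset.mem_Ioc.1 hn
      have hnR : (n : ℝ) ≤ (R : ℝ) ^ 2 := by exact_mod_cast hn1
      have hi := integral_centeredFractPow_mul_le hN hn0 hT0
        ((mul_le_mul_of_nonneg_right hnR hT0).trans hR)
      have := mul_le_mul_of_nonneg_left hi (hc n hn0)
      linarith
    · intro n _
      exact (intervalIntegrable_of_measurable_of_abs_le (measurable_centeredFractPow_mul N n)
        (fun x => abs_centeredFractPow_le N _) 0 T).const_mul _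
  linarith

/-- The sum of the series is not essentially bounded below near `0`. -/
theorem not_ae_le_tsum_davenportBlock {a : ℝ → ℝ} (ha0 : ∀ t : ℝ, 1 ≤ t → 0 ≤ a t)
    (ham : MonotoneOn a (Set.Ici 1)) (hane : ∃ n : ℕ, 1 ≤ n ∧ a (n : ℝ) ≠ 0) {K : ℝ}
    (hK0 : 0 ≤ K) (hK : ∀ n : ℕ, 1 ≤ n → a n ≤ K * (n : ℝ) ^ (1 / 8 : ℝ)) {N : ℕ} (hN : 1 ≤ N)
    (B : ℝ) {T₀ : ℝ} (hT₀ : 0 < T₀) :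
    ¬ ∀ᵐ x ∂(volume.restrict (Set.Ioc 0 T₀)), B ≤ ∑' k, davenportBlock a N k x := by
  intro hae
  have hsq : Tendsto (fun R : ℕ => R ^ 2) atTop atTop := tendsto_pow_atTop two_ne_zero
  have hsmall : Tendsto (fun R : ℕ => (1 : ℝ) / (2 * ((R ^ 2 : ℕ) : ℝ))) atTop (𝓝 0) := by
    have h := ((tendsto_natCast_atTop_atTop (R := ℝ)).comp hsq).const_mul_atTop
      (show (0 : ℝ) < 2 by norm_num)
    exact h.inv_tendsto_atTop.congr fun R => by simp
  obtain ⟨R, hRB, hRT, hR1⟩ := ((hsq.eventually (eventually_lt_sum_coeff ha0 ham hane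
    (2 * ((N : ℝ) + 1) * |B|))).and ((hsmall.eventually_lt_const hT₀).and
      (eventually_ge_atTop 1))).exists
  set T : ℝ := 1 / (2 * ((R ^ 2 : ℕ) : ℝ)) with hT
  have hR1' : (1 : ℝ) ≤ ((R ^ 2 : ℕ) : ℝ) := by exact_mod_cast Nat.one_le_pow _ _ hR1
  have hT0 : 0 < T := by positivity
  have hT1 : T ≤ 1 := by
    rw [hT, div_le_one (by positivity)]
    linarith
  have hRT' : (R : ℝ) ^ 2 * T ≤ 1 / 2 := by
    rw [hT]
    push_cast at hR1' ⊢
    apply le_of_eq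
    field_simp
  have hup := setIntegral_tsum_davenportBlock_le ha0 ham hK0 hK hN hT0.le hT1 hRT'
  have hlow : -(|B| * T) ≤ ∫ x in Set.Ioc 0 T, ∑' k, davenportBlock a N k x := by
    by_cases hint : Integrable (fun x => ∑' k, davenportBlock a N k x)
        (volume.restrict (Set.Ioc 0 T))
    · have hmono := integral_mono_ae (integrable_const (-|B|)) hint
        ((ae_restrict_of_ae_restrict_of_subset
          (Set.Ioc_subset_Ioc_right hRT.le) hae).mono fun x hx => (neg_abs_le B).trans hx)
      have hconst : ∫ _x in Set.Ioc 0 T, -|B| = -(|B| * T) := by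
        rw [← intervalIntegral.integral_of_le hT0.le, intervalIntegral.integral_const,
          smul_eq_mul]
        ring
      rwa [hconst] at hmono
    · -- The sum is integrable, but with the value `0` of the integral otherwise, the bound
      -- needs no proof of it.
      rw [integral_undef hint, neg_nonpos]
      positivity
  have hN' : (0 : ℝ) < 2 * ((N : ℝ) + 1) := by positivity
  have h1 : T / (2 * ((N : ℝ) + 1)) * (2 * ((N : ℝ) + 1) * |B|)
      < T / (2 * ((N : ℝ) + 1)) * ∑ n ∈ Finset.Ioc 0 (R ^ 2), a n / n :=
    mul_lt_mul_of_pos_left hRB (by positivity)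
  have h2 : T / (2 * ((N : ℝ) + 1)) * (2 * ((N : ℝ) + 1) * |B|) = |B| * T := by
    field_simp
  linarith

theorem ae_irrational_sub (z : ℝ) : ∀ᵐ x : ℝ, Irrational (z - x) := by
  have hc : (Set.range ((↑) : ℚ → ℝ)).Countable := Set.countable_range _
  have hi : {x : ℝ | z - x ∈ Set.range ((↑) : ℚ → ℝ)}.Countable := by
    refine (hc.image fun y => z - y).mono ?_
    intro x hx
    exact ⟨z - x, hx, by ring⟩
  have h0 := hi.measure_zero volume
  rw [ae_iff]
  simpa [Irrational] using h0

theorem ae_irrational : ∀ᵐ x : ℝ, Irrational x := by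
  filter_upwards [ae_irrational_sub 0] with x hx
  simpa using hx

theorem exists_mem_Ioc_of_ae {p : ℝ → Prop} {s t : ℝ} (hst : s < t)
    (h : ∀ᵐ x ∂(volume.restrict (Set.Ioc s t)), p x) : ∃ x ∈ Set.Ioc s t, p x := by
  have hne : (ae (volume.restrict (Set.Ioc s t))).NeBot := by
    rw [ae_neBot, Ne, Measure.restrict_eq_zero, Real.volume_Ioc, ENNReal.ofReal_eq_zero]
    linarith
  obtain ⟨x, hx, hx'⟩ := ((ae_restrict_mem measurableSet_Ioc).and h).exists
  exact ⟨x, hx, hx'⟩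

theorem theorem2p3 (a : ℝ → ℝ)
    (ha_nonneg : ∀ t : ℝ, 1 ≤ t → 0 ≤ a t)
    (ha_mono : MonotoneOn a (Set.Ici 1))
    (ha_ne : ∃ n : ℕ, 1 ≤ n ∧ a (n : ℝ) ≠ 0)
    (hL : DirichletSeriesAnalytic a)
    (N : ℕ) (hN : 1 ≤ N) :
    davenportP a N ∉ classK (fun h : ℝ => h⁻¹ * a (1 / h)) := by
  rintro ⟨C, hC⟩
  obtain ⟨K, hK0, hK⟩ := exists_le_mul_rpow_of_lseriesSummable ha_nonneg ha_mono
    (hL.1 ((9 / 8 : ℝ) : ℂ) (by rw [Complex.ofReal_re]; norm_num))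
  obtain ⟨δ, hδ0, hδ⟩ := mem_nhdsGT_iff_exists_Ioo_subset.1 hC
  have hδ0' : 0 < δ := hδ0
  have hsum := ae_summable_davenportBlock ha_nonneg ha_mono hK0 hK N
  have hmem : ∀ x, Summable (fun k => davenportBlock a N k x) →
      ∑' k, davenportBlock a N k x ∈ davenportP a N x := fun x hx =>
    (mem_davenportP_iff a N x _).2
      (tendsto_davenportPartialSum ha_nonneg ha_mono hK0 hK hN hx)
  have hr : 0 < min (δ / 2) 1 := lt_min (by linarith) one_pos
  obtain ⟨z, ⟨hz0, hzr⟩, hzsum⟩ := exists_mem_Ioc_of_ae hr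
    (ae_restrict_of_ae_restrict_of_subset (Set.Ioc_subset_Ioc_right (min_le_right _ _)) hsum)
  have hzδ : z ≤ δ / 2 := hzr.trans (min_le_left _ _)
  have hz1 : z ≤ 1 := hzr.trans (min_le_right _ _)
  set P : ℝ → ℝ := fun x => ∑' k, davenportBlock a N k x with hP
  -- For `x` in `(0, z/2]` the increment `z - x` stays away from `0`, so the modulus is bounded.
  set V : ℝ := 2 / z * a (2 / z) with hV
  refine not_ae_le_tsum_davenportBlock ha_nonneg ha_mono ha_ne hK0 hK hN (P z - |C| * V)
    (half_pos hz0) ?_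
  filter_upwards [ae_restrict_of_ae_restrict_of_subset
      (Set.Ioc_subset_Ioc_right (show z / 2 ≤ 1 by linarith)) hsum,
    ae_restrict_of_ae ae_irrational, ae_restrict_of_ae (ae_irrational_sub z),
    ae_restrict_mem measurableSet_Ioc] with x hxsum hxirr hzx hx
  obtain ⟨hx0, hxz⟩ := hx
  have hh0 : 0 < z - x := by linarith
  have hdiff := hδ (show z - x ∈ Set.Ioo 0 δ from ⟨hh0, by linarith⟩) hzx x hxirr (P x)
    (hmem x hxsum) (P z) (by rw [add_sub_cancel]; exact hmem z hzsum)
  have hinv1 : 1 ≤ 1 / (z - x) := by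
    rw [le_div_iff₀ hh0]
    linarith
  have hinv2 : 1 / (z - x) ≤ 2 / z := by
    rw [div_le_div_iff₀ hh0 hz0]
    linarith
  have ha1 := ha_nonneg _ hinv1
  have ha2 := ha_mono hinv1 (Set.mem_Ici.2 (hinv1.trans hinv2)) hinv2
  have hvV : |(z - x)⁻¹ * a (1 / (z - x))| ≤ V := by
    rw [← one_div, abs_of_nonneg (by positivity)]
    exact mul_le_mul hinv2 ha2 ha1 (by positivity)
  have h1 : C * |(z - x)⁻¹ * a (1 / (z - x))| ≤ |C| * V :=
    mul_le_mul (le_abs_self C) hvV (abs_nonneg _) (abs_nonneg _)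
  have h2 := (abs_le.1 (hdiff.trans h1)).2
  change P z - |C| * V ≤ P x
  linarith
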